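/- **Setting.** Let $\mathcal G=(\mathcal V,\mathcal E)$ be a finite multi-graph (multiple edges and self-edges allowed). Each edge $\alpha$ carries two directed edges $\alpha_d,\bar\alpha_d$, each attached to one end of $\alpha$ (to the same node if $\alpha$ is a self-edge); $e_d(a)$ is the set of directed edges at the node $a$ and $u(d)$ is the edge underlying the directed edge $d$. A Multi-GM consists of factors $f_a:\{0,1\}^{e_d(a)}\to[0,\infty)$, $a\in\mathcal V$, whose partition function $$Z=\sum_{\sigma\in\{0,1\}^{\mathcal E}}\prod_{a\in\mathcal V}f_a(\sigma_a),\qquad (\sigma_a)_d=\sigma_{u(d)},$$ is positive. Its polynomial, in the variables $x_d$ indexed by the directed edges $d$, is $$h(x)=\prod_{a\in\mathcal V}\ \sum_{s\in\{0,1\}^{e_d(a)}}f_a(s)\prod_{d\in e_d(a)}x_d^{s_d}.$$ A real polynomial is *real stable* if it is nonzero and has no complex zero all of whose coordinates have positive imaginary part; $h$ is *Bi-Stable* if it becomes real stable after replacing $x_{\bar\alpha_d}$ by $-x_{\bar\alpha_d}$ for all $\alpha\in\mathcal E$. The *variational BP estimate* $Z^{\rm vbp}$ is defined by $$-\log Z^{\rm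 vbp}=\min_{(b,\beta)\in\Pi}\Big(\sum_{a\in\mathcal V}\sum_{s}b_a(s)\log\frac{b_a(s)}{f_a(s)}-\sum_{\alpha\in\mathcal E}\big(\beta_\alpha\log\beta_\alpha+(1-\beta_\alpha)\log(1-\beta_\alpha)\big)\Big),$$ where $\Pi$ is the set of all $b_a(s)\in[0,1]$ ($a\in\mathcal V$, $s\in\{0,1\}^{e_d(a)}$) and $\beta_\alpha\in[0,1]$ ($\alpha\in\mathcal E$) with $\sum_s b_a(s)=1$ for all $a$ and $\sum_{s:\,s_d=1}b_a(s)=\beta_{u(d)}$ for all $a$ and $d\in e_d(a)$. Here $0\log 0=0$, a term $b\log(b/f)$ is $0$ if $b=0$ and $+\infty$ if $b>0=f$, and $-\log 0=+\infty$. *Contraction* of an edge $\alpha$ removes $\alpha$, merges its ends into one node, gives this node the factor $\sum_{\sigma_\alpha\in\{0,1\}}\prod_b f_b$, where the product is over the ends $b$ of $\alpha$ (two distinct nodes, or one if $\alpha$ is a self-edge) and both directed edges of $\alpha$ take the value $\sigma_\alpha$, and keeps all other factors. **Theorem (Monotonicity of Variational BP).** Consider a Multi-GM whose polynomial $h$ is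 Bi-Stable, and a sequence of Multi-GMs, $m=0,1,\dots,|\mathcal E|$, which starts with it and in which each next Multi-GM arises from the preceding one by contraction of one edge (the edges are contracted in an arbitrary order). Let $h^{(m)}$ and $Z^{(m;\rm vbp)}$ be the polynomial and the variational BP estimate of the $m$-th Multi-GM. Then 1. every polynomial $h^{(m)}$, $0\le m\le|\mathcal E|$, is Bi-Stable; 2. $Z^{\rm vbp}=Z^{(0;\rm vbp)}\le Z^{(1;\rm vbp)}\le\dots\le Z^{(|\mathcal E|;\rm vbp)}=Z$. -/

import Mathlib

universe u v

noncomputable section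

/-- A (binary, edge-variable) multi-graph model. The multi-graph has finite node set `V` and finite
edge set `E`; several edges may join the same two nodes and self-edges are allowed. Every undirected
edge `α` carries the two directed edges `(α, false)` (the primary orientation) and `(α, true)`
(its reversal), and `node d` is the node to which the directed edge `d` belongs. The factor of a
node `a` is a function of one bit for each directed edge at `a`. -/
structure MultiGM where
  V : Type u
  E : Type v
  [fintypeV : Fintype V]
  [decEqV : DecidableEq V]
  [fintypeE : Fintype E]
  [decEqE : DecidableEq E]
  node : E × Bool → V
  factor : (a : V) → ({d : E × Bool // node d = a} → Bool) → ℝ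

namespace MultiGM

attribute [instance] fintypeV decEqV fintypeE decEqE

/-- The set of directed edges at the node `a`. -/
abbrev DirEdges (G : MultiGM.{u, v}) (a : G.V) : Type v := {d : G.E × Bool // G.node d = a}

/-- The local configurations at the node `a`: one bit for every directed edge at `a`. -/
abbrev LocalConfig (G : MultiGM.{u, v}) (a : G.V) : Type v := G.DirEdges a → Bool

/-- The partition function: sum over all edge configurations of the product of the factors. -/
def partitionFunction (G : MultiGM.{u, v}) : ℝ :=
  ∑ σ : G.E → Bool, ∏ a : G.V, G.factor a (fun d => σ d.1.1)

/-! ### Polynomials -/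

/-- The polynomial of a node: `h_a = ∑_s f_a(s) ∏_d x_d ^ (s_d)`, with `d` over the directed edges
at `a`. -/
def nodePoly (G : MultiGM.{u, v}) (a : G.V) : MvPolynomial (G.E × Bool) ℝ :=
  ∑ s : G.LocalConfig a,
    MvPolynomial.C (G.factor a s) * ∏ d : G.DirEdges a, MvPolynomial.X d.1 ^ (s d).toNat

/-- The polynomial of the model: the product of the polynomials of its nodes. -/
def poly (G : MultiGM.{u, v}) : MvPolynomial (G.E × Bool) ℝ := ∏ a : G.V, G.nodePoly a

end MultiGM

/-- Real stability: a nonzero real polynomial without zeros all of whose coordinates have positive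
imaginary part. -/
def RealStable {ι : Type*} (g : MvPolynomial ι ℝ) : Prop :=
  g ≠ 0 ∧ ∀ z : ι → ℂ, (∀ i, 0 < (z i).im) → MvPolynomial.aeval z g ≠ 0

/-- Bi-stability: the polynomial becomes real stable when, for every edge, the variable of the
reversed directed edge is replaced by its negative. -/
def BiStable {E : Type*} (h : MvPolynomial (E × Bool) ℝ) : Prop :=
  RealStable (MvPolynomial.aeval
    (fun d : E × Bool => if d.2 then -(MvPolynomial.X d : MvPolynomial (E × Bool) ℝ)
      else MvPolynomial.X d) h)

namespace MultiGM

/-! ### Variational belief propagation -/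

/-- Candidate beliefs: a number for every local configuration of every node, and a number for every
edge. -/
abbrev Beliefs (G : MultiGM.{u, v}) : Type _ := ((a : G.V) → G.LocalConfig a → ℝ) × (G.E → ℝ)

/-- The belief polytope. -/
def beliefPolytope (G : MultiGM.{u, v}) : Set G.Beliefs :=
  {p | (∀ a s, p.1 a s ∈ Set.Icc (0 : ℝ) 1) ∧ (∀ α, p.2 α ∈ Set.Icc (0 : ℝ) 1) ∧
    (∀ a, ∑ s : G.LocalConfig a, p.1 a s = 1) ∧
    (∀ (a : G.V) (d : G.DirEdges a),
      ∑ s : G.LocalConfig a with s d = true, p.1 a s = p.2 d.1.1)}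

/-- The Bethe self-energy `-∑_a ∑_s b_a(s) log f_a(s)`, with `log 0 = -∞` and `0 * log 0 = 0`: it is
`+∞` as soon as a configuration with zero factor has nonzero belief. -/
def betheEnergy (G : MultiGM.{u, v}) (p : G.Beliefs) : EReal :=
  open Classical in
  if ∀ a s, G.factor a s = 0 → p.1 a s = 0 then
    ((-∑ a, ∑ s, p.1 a s * Real.log (G.factor a s) : ℝ) : EReal)
  else ⊤

/-- The Bethe entropy
`-∑_a ∑_s b_a(s) log b_a(s) + ∑_α (β_α log β_α + (1 - β_α) log (1 - β_α))`, with `0 log 0 = 0`. -/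
def betheEntropy (G : MultiGM.{u, v}) (p : G.Beliefs) : ℝ :=
  -∑ a, ∑ s, p.1 a s * Real.log (p.1 a s) +
    ∑ α, (p.2 α * Real.log (p.2 α) + (1 - p.2 α) * Real.log (1 - p.2 α))

/-- The Bethe free energy. -/
def betheFreeEnergy (G : MultiGM.{u, v}) (p : G.Beliefs) : EReal :=
  G.betheEnergy p - (G.betheEntropy p : EReal)

/-- The variational Bethe free energy: the minimum of the Bethe free energy over the belief
polytope (written as an infimum in `[-∞, +∞]`; the polytope is compact and nonempty). -/
def variationalFreeEnergy (G : MultiGM.{u, v}) : EReal :=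
  ⨅ p ∈ G.beliefPolytope, G.betheFreeEnergy p

/-- The variational belief propagation estimate `Z_vbp` of the partition function, determined by
`-log Z_vbp = ` the variational Bethe free energy. -/
def Zvbp (G : MultiGM.{u, v}) : ENNReal := EReal.exp (-G.variationalFreeEnergy)

/-! ### Contraction of an edge -/

/-- Nodes that remain when the edge `α` is contracted: the end `node (α, !s)` is dropped and the end
`node (α, s)` is kept. If `α` is a self-edge then all nodes remain. -/
abbrev ContractV (G : MultiGM.{u, v}) (α : G.E) (s : Bool) : Type u :=
  {a : G.V // a = G.node (α, s) ∨ a ≠ G.node (α, !s)}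

/-- The map on nodes that moves the dropped end of `α` to the kept one. -/
def merge (G : MultiGM.{u, v}) (α : G.E) (s : Bool) (a : G.V) : G.ContractV α s :=
  if h : a = G.node (α, !s) then ⟨G.node (α, s), Or.inl rfl⟩ else ⟨a, Or.inr h⟩

theorem merge_coe (G : MultiGM.{u, v}) (α : G.E) (s : Bool) (a : G.ContractV α s) :
    G.merge α s a.1 = a := by
  unfold merge
  split_ifs with h
  · apply Subtype.ext
    rcases a.2 with h' | h'
    · exact h'.symm
    · exact absurd h h'
  · rfl

/-- The directed edge of the contracted multi-graph, seen as a node-carrying directed edge of the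
old multi-graph and moved along `merge`. -/
def contractNode (G : MultiGM.{u, v}) (α : G.E) (s : Bool) (d : {e : G.E // e ≠ α} × Bool) :
    G.ContractV α s :=
  G.merge α s (G.node (d.1.1, d.2))

/-- A configuration `x` of the directed edges at the node `a` of the contracted multi-graph,
together with a bit `t` for the contracted edge `α`, gives a local configuration at each old node
`b` that is merged into `a`: both directed edges of `α` get the bit `t`. -/
def restore (G : MultiGM.{u, v}) (α : G.E) (s : Bool) (t : Bool) {a : G.ContractV α s}
    (x : {d : {e : G.E // e ≠ α} × Bool // G.contractNode α s d = a} → Bool)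
    (b : G.V) (hb : G.merge α s b = a) : G.LocalConfig b :=
  fun d => if h : d.1.1 = α then t else
    x ⟨(⟨d.1.1, h⟩, d.1.2), (congrArg (G.merge α s) d.2).trans hb⟩

/-- Contraction of the edge `α`, where the end `node (α, s)` is kept. The factor of the kept end is
the sum over the bit of `α` of the product of the factors of the ends of `α` (two factors, or one
if `α` is a self-edge; these ends are exactly the old nodes merged into the kept end). The factors
of the other nodes do not change (`α` is not incident to them, so that the bit passed to `restore`
is irrelevant there). -/
def contract (G : MultiGM.{u, v}) (α : G.E) (s : Bool) : MultiGM.{u, v} where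
  V := G.ContractV α s
  E := {e : G.E // e ≠ α}
  node := G.contractNode α s
  factor a x :=
    if a.1 = G.node (α, s) then
      ∑ t : Bool, ∏ b : {b : G.V // G.merge α s b = a},
        G.factor b.1 (G.restore α s t x b.1 b.2)
    else G.factor a.1 (G.restore α s false x a.1 (G.merge_coe α s a))

/-- `S 0, S 1, …, S |E|` is a sequence of models that starts with `G` and in which every next model
arises from the preceding one by contraction of one of its edges (of arbitrary choice, with an
arbitrary choice of the end that is kept). -/
structure IsContractionSequence (G : MultiGM.{u, v}) (S : ℕ → MultiGM.{u, v}) : Prop where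
  zero : S 0 = G
  succ : ∀ m < Fintype.card G.E, ∃ (α : (S m).E) (s : Bool), S (m + 1) = (S m).contract α s

end MultiGM

end

open MvPolynomial

namespace MultiGM

/-- The product of all factors at a configuration of the directed edges. -/
def weight (G : MultiGM.{u, v}) (τ : G.E × Bool → Bool) : ℝ :=
  ∏ a : G.V, G.factor a (fun d => τ d.1)

/-- A configuration of all directed edges is a family of local configurations. -/
def configEquiv (G : MultiGM.{u, v}) : (G.E × Bool → Bool) ≃ ((a : G.V) → G.LocalConfig a) where
  toFun τ a d := τ d.1
  invFun p d := p (G.node d) ⟨d, rfl⟩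
  left_inv _ := rfl
  right_inv p := by
    funext a ⟨d, hd⟩
    subst hd
    rfl

theorem aeval_nodePoly (G : MultiGM.{u, v}) {R : Type*} [CommRing R] [Algebra ℝ R]
    (z : G.E × Bool → R) (a : G.V) :
    aeval z (G.nodePoly a) = ∑ s : G.LocalConfig a,
      algebraMap ℝ R (G.factor a s) * ∏ d : G.DirEdges a, z d.1 ^ (s d).toNat := by
  simp [nodePoly]

theorem aeval_poly (G : MultiGM.{u, v}) {R : Type*} [CommRing R] [Algebra ℝ R]
    (z : G.E × Bool → R) :
    aeval z G.poly =
      ∑ τ : G.E × Bool → Bool, algebraMap ℝ R (G.weight τ) * ∏ d, z d ^ (τ d).toNat := by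
  simp only [poly, map_prod, aeval_nodePoly]
  rw [Finset.prod_univ_sum, Fintype.piFinset_univ, ← G.configEquiv.sum_comp]
  refine Finset.sum_congr rfl fun τ _ => ?_
  rw [Finset.prod_mul_distrib, weight, map_prod,
    ← Fintype.prod_fiberwise G.node (fun d => z d ^ (τ d).toNat)]
  rfl

end MultiGM

/-- Extends a function on the directed edges other than those of `α`. -/
def extendPair {E X : Type*} [DecidableEq E] (α : E) (τ : {e : E // e ≠ α} × Bool → X) (x y : X)
    (d : E × Bool) : X :=
  if h : d.1 = α then (if d.2 then y else x) else τ (⟨d.1, h⟩, d.2)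

section extendPair

variable {E X : Type*} [DecidableEq E] (α : E)

section

variable (τ : {e : E // e ≠ α} × Bool → X) (x y : X)

@[simp] theorem extendPair_false : extendPair α τ x y (α, false) = x := by simp [extendPair]

@[simp] theorem extendPair_true : extendPair α τ x y (α, true) = y := by simp [extendPair]

@[simp] theorem extendPair_of_ne (e : {e : E // e ≠ α}) (i : Bool) :
    extendPair α τ x y (e.1, i) = τ (e, i) := by
  simp [extendPair, e.2]

end

/-- Functions on all directed edges, split at the two directed edges of `α`. -/
def extendPairEquiv :
    ({e : E // e ≠ α} × Bool → X) × (X × X) ≃ (E × Bool → X) where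
  toFun p := extendPair α p.1 p.2.1 p.2.2
  invFun τ := (fun d => τ (d.1.1, d.2), τ (α, false), τ (α, true))
  left_inv p := by
    ext
    · simp
    · simp
    · simp
  right_inv τ := by
    funext ⟨e, i⟩
    by_cases h : e = α
    · subst h
      cases i <;> simp
    · exact extendPair_of_ne α _ _ _ ⟨e, h⟩ i

theorem sum_config_extendPair [Fintype E] {M : Type*} [AddCommMonoid M]
    (f : (E × Bool → Bool) → M) :
    ∑ τ, f τ = ∑ x, ∑ y, ∑ τ, f (extendPair α τ x y) := by
  rw [← (extendPairEquiv α (X := Bool)).sum_comp, Fintype.sum_prod_type, Finset.sum_comm,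
    Fintype.sum_prod_type]
  rfl

@[to_additive]
theorem prod_extendPair [Fintype E] {M : Type*} [CommMonoid M] (f : E × Bool → M) :
    ∏ d, f d = f (α, false) * f (α, true) * ∏ d : {e : E // e ≠ α} × Bool, f (d.1.1, d.2) := by
  rw [Fintype.prod_prod_type, Fintype.prod_prod_type,
    ← Fintype.prod_subtype_mul_prod_subtype (fun e => e = α)]
  congr 1
  have h : ((default : {e : E // e = α}) : E) = α := rfl
  simp [mul_comm, h]

end extendPair

namespace MultiGM

variable (G : MultiGM.{u, v}) (α : G.E) (s : Bool)

theorem merge_node (i : Bool) : G.merge α s (G.node (α, i)) = ⟨G.node (α, s), Or.inl rfl⟩ := by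
  unfold merge
  split_ifs with h
  · rfl
  · have : i = s := by
      by_contra hi
      exact h (by rw [Bool.eq_not_of_ne hi])
    subst this
    rfl

theorem eq_of_merge_eq {a : G.ContractV α s} (ha : a.1 ≠ G.node (α, s)) {b : G.V}
    (hb : G.merge α s b = a) : b = a.1 := by
  unfold merge at hb
  split_ifs at hb with h
  · exact absurd (congrArg Subtype.val hb).symm ha
  · exact congrArg Subtype.val hb

theorem restore_eq (t : Bool) (τ : {e : G.E // e ≠ α} × Bool → Bool) {a : G.ContractV α s}
    (b : G.V) (hb : G.merge α s b = a) :
    G.restore α s t (a := a) (fun d => τ d.1) b hb = fun d => extendPair α τ t t d.1 := by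
  funext d
  simp [restore, extendPair]

theorem contract_factor (t : Bool) (τ : {e : G.E // e ≠ α} × Bool → Bool) {a : G.ContractV α s}
    (ha : a.1 ≠ G.node (α, s)) :
    (G.contract α s).factor a (fun d => τ d.1) =
      ∏ b : {b : G.V // G.merge α s b = a}, G.factor b.1 (fun d => extendPair α τ t t d.1) := by
  have hu : ∀ b : {b : G.V // G.merge α s b = a}, b = ⟨a.1, G.merge_coe α s a⟩ := fun b =>
    Subtype.ext (G.eq_of_merge_eq α s ha b.2)
  rw [Fintype.prod_eq_single ⟨a.1, G.merge_coe α s a⟩ (fun b hb => absurd (hu b) hb)]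
  change (if a.1 = G.node (α, s) then _ else _) = _
  rw [if_neg ha]
  congr 1
  funext d
  have hd : d.1.1 ≠ α := by
    intro h
    have h1 := G.merge_node α s d.1.2
    have h2 : G.node (α, d.1.2) = a.1 := (congrArg (fun e => G.node (e, d.1.2)) h).symm.trans d.2
    rw [h2, G.merge_coe α s a] at h1
    exact ha (congrArg Subtype.val h1)
  simp [restore, extendPair, hd]

theorem weight_contract (τ : {e : G.E // e ≠ α} × Bool → Bool) :
    (G.contract α s).weight τ = ∑ t, G.weight (extendPair α τ t t) := by
  have h1 : ∀ t, G.weight (extendPair α τ t t) = ∏ a : G.ContractV α s,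
      ∏ b : {b : G.V // G.merge α s b = a}, G.factor b.1 (fun d => extendPair α τ t t d.1) :=
    fun t => (Fintype.prod_fiberwise (G.merge α s)
      (fun b => G.factor b (fun d => extendPair α τ t t d.1))).symm
  simp only [h1]
  set k : G.ContractV α s := ⟨G.node (α, s), Or.inl rfl⟩ with hk
  have h2 : (G.contract α s).weight τ = ∏ a : G.ContractV α s,
    (G.contract α s).factor a (fun d => τ d.1) := rfl
  rw [h2, Fintype.prod_eq_mul_prod_compl k]
  simp only [fun t => Fintype.prod_eq_mul_prod_compl k (fun a : G.ContractV α s =>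
      ∏ b : {b : G.V // G.merge α s b = a}, G.factor b.1 (fun d => extendPair α τ t t d.1))]
  have h3 : ∀ t, ∏ a ∈ ({k}ᶜ : Finset (G.ContractV α s)),
      ∏ b : {b : G.V // G.merge α s b = a}, G.factor b.1 (fun d => extendPair α τ t t d.1) =
      ∏ a ∈ ({k}ᶜ : Finset (G.ContractV α s)), (G.contract α s).factor a (fun d => τ d.1) := by
    intro t
    refine Finset.prod_congr rfl fun a ha => ?_
    rw [G.contract_factor α s t τ]
    intro h
    simp only [Finset.mem_compl, Finset.mem_singleton] at ha
    exact ha (Subtype.ext h)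
  simp only [h3, ← Finset.sum_mul]
  congr 1
  change (if k.1 = G.node (α, s) then _ else _) = _
  rw [if_pos rfl]
  simp only [← G.restore_eq α s]
  rfl

theorem partitionFunction_eq_sum_weight :
    G.partitionFunction = ∑ σ : G.E → Bool, G.weight (fun d => σ d.1) := rfl

theorem partitionFunction_contract :
    (G.contract α s).partitionFunction = G.partitionFunction := by
  rw [partitionFunction_eq_sum_weight, partitionFunction_eq_sum_weight]
  have h1 : ∀ σ : {e : G.E // e ≠ α} → Bool, (G.contract α s).weight (fun d => σ d.1) =
      ∑ t, G.weight (extendPair α (fun d => σ d.1) t t) := fun σ => G.weight_contract α s _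
  have h2 : ∑ σ : (G.contract α s).E → Bool, (G.contract α s).weight (fun d => σ d.1) =
      ∑ σ : {e : G.E // e ≠ α} → Bool, ∑ t, G.weight (extendPair α (fun d => σ d.1) t t) :=
    Finset.sum_congr rfl fun σ _ => h1 σ
  rw [h2, ← (Equiv.funSplitAt α Bool).symm.sum_comp, Fintype.sum_prod_type, Finset.sum_comm]
  refine Finset.sum_congr rfl fun t _ => Finset.sum_congr rfl fun σ _ => ?_
  congr 1
  funext ⟨e, i⟩
  by_cases h : e = α <;> simp [extendPair, h]

/-- The coefficients of the polynomial of `G` with respect to the two variables of the edge `α`,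
evaluated at `z`. -/
def pairCoeff {R : Type*} [CommRing R] [Algebra ℝ R] (z : {e : G.E // e ≠ α} × Bool → R)
    (i j : Bool) : R :=
  ∑ τ : {e : G.E // e ≠ α} × Bool → Bool,
    algebraMap ℝ R (G.weight (extendPair α τ i j)) * ∏ d, z d ^ (τ d).toNat

theorem aeval_poly_extendPair {R : Type*} [CommRing R] [Algebra ℝ R]
    (z : {e : G.E // e ≠ α} × Bool → R) (x y : R) :
    aeval (extendPair α z x y) G.poly = G.pairCoeff α z false false +
      G.pairCoeff α z true false * x + G.pairCoeff α z false true * y +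
      G.pairCoeff α z true true * x * y := by
  rw [aeval_poly, sum_config_extendPair α]
  have h : ∀ i j, ∑ τ : {e : G.E // e ≠ α} × Bool → Bool,
      algebraMap ℝ R (G.weight (extendPair α τ i j)) *
        ∏ d, extendPair α z x y d ^ (extendPair α τ i j d).toNat =
      G.pairCoeff α z i j * (x ^ i.toNat * y ^ j.toNat) := by
    intro i j
    rw [pairCoeff, Finset.sum_mul]
    refine Finset.sum_congr rfl fun τ _ => ?_
    rw [prod_extendPair α]
    simp only [extendPair_false, extendPair_true, extendPair_of_ne]
    ring
  simp only [h, Fintype.sum_bool]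
  simp
  ring

theorem aeval_contract_poly {R : Type*} [CommRing R] [Algebra ℝ R]
    (z : {e : G.E // e ≠ α} × Bool → R) :
    aeval z (G.contract α s).poly =
      G.pairCoeff α z false false + G.pairCoeff α z true true := by
  refine ((G.contract α s).aeval_poly z).trans ?_
  have h : ∀ τ : {e : G.E // e ≠ α} × Bool → Bool,
      algebraMap ℝ R ((G.contract α s).weight τ) = ∑ t,
        algebraMap ℝ R (G.weight (extendPair α τ t t)) := fun τ => by
    rw [weight_contract, map_sum]
  refine (Finset.sum_congr rfl fun τ _ => congrArg (· * _) (h τ)).trans ?_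
  simp only [Fintype.sum_bool, add_mul]
  rw [add_comm (G.pairCoeff α z false false)]
  exact Finset.sum_add_distrib

theorem contract_factor_nonneg (hf : ∀ a s, 0 ≤ G.factor a s) (a : (G.contract α s).V)
    (x : (G.contract α s).LocalConfig a) : 0 ≤ (G.contract α s).factor a x := by
  simp only [contract]
  split_ifs
  · exact Finset.sum_nonneg fun t _ => Finset.prod_nonneg fun b _ => hf _ _
  · exact hf _ _

theorem card_contract : Fintype.card (G.contract α s).E + 1 = Fintype.card G.E := by
  have h : Fintype.card (G.contract α s).E = Fintype.card {e : G.E // e ≠ α} := rfl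
  have := Fintype.card_pos_iff.mpr ⟨α⟩
  rw [h, Fintype.card_subtype_compl, Fintype.card_subtype_eq]
  omega

end MultiGM

/-- The points that have positive imaginary parts after the coordinates of the reversed directed
edges are negated. -/
def signedHalfSpace (E : Type*) : Set (E × Bool → ℂ) :=
  {z | ∀ d : E × Bool, 0 < (if d.2 then -z d else z d).im}

theorem biStable_iff {E : Type*} (h : MvPolynomial (E × Bool) ℝ) :
    BiStable h ↔ ∀ z ∈ signedHalfSpace E, aeval z h ≠ 0 := by
  have key : ∀ z : E × Bool → ℂ, aeval z (aeval (fun d : E × Bool =>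
      if d.2 then -(X d : MvPolynomial (E × Bool) ℝ) else X d) h) =
      aeval (fun d => if d.2 then -z d else z d) h := by
    intro z
    rw [comp_aeval_apply]
    congr 2
    funext d
    split_ifs <;> simp
  have hneg : ∀ z : E × Bool → ℂ, (fun d => if d.2 then -(if d.2 then -z d else z d) else
      (if d.2 then -z d else z d)) = z := by
    intro z
    funext d
    split_ifs <;> simp
  constructor
  · rintro ⟨-, h2⟩ z hz
    have := h2 (fun d => if d.2 then -z d else z d) hz
    rwa [key, hneg] at this
  · intro h2
    have h3 : ∀ z : E × Bool → ℂ, (∀ i, 0 < (z i).im) → aeval z (aeval (fun d : E × Bool =>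
        if d.2 then -(X d : MvPolynomial (E × Bool) ℝ) else X d) h) ≠ 0 := by
      intro z hz
      rw [key]
      refine h2 _ fun d => ?_
      have := congrFun (hneg z) d
      rw [this]
      exact hz d
    refine ⟨fun h0 => h3 (fun _ => Complex.I) (fun _ => by simp) (by rw [h0, map_zero]), h3⟩

theorem extendPair_mem_signedHalfSpace {E : Type*} [DecidableEq E] {α : E}
    {z : {e : E // e ≠ α} × Bool → ℂ} (hz : z ∈ signedHalfSpace {e : E // e ≠ α}) {x y : ℂ}
    (hx : 0 < x.im) (hy : 0 < y.im) : extendPair α z x (-y) ∈ signedHalfSpace E := by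
  rintro ⟨e, i⟩
  by_cases h : e = α
  · subst h
    cases i <;> simpa
  · have := hz (⟨e, h⟩, i)
    simpa [extendPair, h] using this

theorem isOpen_signedHalfSpace (E : Type*) [Finite E] : IsOpen (signedHalfSpace E) := by
  have : signedHalfSpace E = ⋂ d : E × Bool, {z | 0 < (if d.2 then -z d else z d).im} := by
    ext; simp [signedHalfSpace]
  rw [this]
  refine isOpen_iInter_of_finite fun d => isOpen_lt continuous_const ?_
  split_ifs <;> fun_prop

theorem convex_signedHalfSpace (E : Type*) : Convex ℝ (signedHalfSpace E) := by
  intro z hz w hw a b ha hb hab d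
  have h1 := hz d
  have h2 := hw d
  simp only [Pi.add_apply, Pi.smul_apply]
  split_ifs with h <;> simp only [h, if_true, if_false, Bool.false_eq_true] at h1 h2
  · simp only [Complex.neg_im, Complex.add_im, Complex.real_smul, Complex.im_ofReal_mul] at *
    rcases ha.eq_or_lt with rfl | ha
    · nlinarith
    · nlinarith [mul_nonneg hb h2.le, mul_pos ha h1]
  · simp only [Complex.add_im, Complex.real_smul, Complex.im_ofReal_mul] at *
    rcases ha.eq_or_lt with rfl | ha
    · nlinarith
    · nlinarith [mul_nonneg hb h2.le, mul_pos ha h1]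

/-- A real point, moved into the signed half-space. -/
def signedShift {E : Type*} (x : E × Bool → ℝ) (ε : ℝ) (d : E × Bool) : ℂ :=
  x d + (if d.2 then -ε else ε : ℝ) * Complex.I

theorem signedShift_mem {E : Type*} (x : E × Bool → ℝ) {ε : ℝ} (hε : 0 < ε) :
    signedShift x ε ∈ signedHalfSpace E := by
  intro d
  unfold signedShift
  split_ifs <;> simpa

theorem signedShift_zero {E : Type*} (x : E × Bool → ℝ) :
    signedShift x 0 = fun d => (x d : ℂ) := by
  funext d
  simp [signedShift]

theorem continuous_signedShift {E : Type*} (x : E × Bool → ℝ) :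
    Continuous (signedShift x) := by
  refine continuous_pi fun d => ?_
  unfold signedShift
  split_ifs <;> fun_prop

theorem Complex.norm_le_norm_of_quadratic_ne_zero {a b d : ℂ}
    (h : ∀ t : ℂ, ‖t‖ < 1 → a + b * t + d * t ^ 2 ≠ 0) : ‖d‖ ≤ ‖a‖ := by
  by_contra! hlt
  have hd : d ≠ 0 := by
    rintro rfl
    rw [norm_zero] at hlt
    exact absurd hlt (not_lt.mpr (norm_nonneg a))
  obtain ⟨w, hw⟩ := IsAlgClosed.exists_pow_nat_eq (b ^ 2 - 4 * d * a) (n := 2) (by norm_num)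
  have hr : ∀ v : ℂ, v ^ 2 = b ^ 2 - 4 * d * a → 1 ≤ ‖(-b + v) / (2 * d)‖ := by
    intro v hv
    by_contra! h1
    refine h _ h1 ?_
    field_simp
    linear_combination hv
  have h1 := hr w hw
  have h2 := hr (-w) (by rw [← hw]; ring)
  have h3 : (-b + w) / (2 * d) * ((-b + -w) / (2 * d)) = a / d := by
    field_simp
    linear_combination -hw
  have h4 : ‖a / d‖ < 1 := by
    rw [norm_div, div_lt_one (norm_pos_iff.mpr hd)]
    exact hlt
  rw [← h3, norm_mul] at h4
  nlinarith

namespace MultiGM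

variable (G : MultiGM.{u, v}) (α : G.E) (s : Bool)

theorem weight_nonneg {G : MultiGM.{u, v}} (hf : ∀ a s, 0 ≤ G.factor a s)
    (τ : G.E × Bool → Bool) : 0 ≤ G.weight τ :=
  Finset.prod_nonneg fun _ _ => hf _ _

theorem exists_weight_pos {G : MultiGM.{u, v}} (hZ : 0 < G.partitionFunction) :
    ∃ τ, 0 < G.weight τ := by
  by_contra! h
  exact absurd hZ (not_lt.mpr (Finset.sum_nonpos fun σ _ => h (fun d => σ d.1)))

theorem aeval_poly_pos {G : MultiGM.{u, v}} (hf : ∀ a s, 0 ≤ G.factor a s)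
    (hZ : 0 < G.partitionFunction) {x : G.E × Bool → ℝ} (hx : ∀ d, 0 < x d) :
    0 < aeval x G.poly := by
  rw [aeval_poly]
  obtain ⟨τ, hτ⟩ := exists_weight_pos hZ
  refine Finset.sum_pos' (fun τ _ => ?_) ⟨τ, Finset.mem_univ _, ?_⟩
  · exact mul_nonneg (weight_nonneg hf τ) (Finset.prod_nonneg fun d _ => (pow_pos (hx d) _).le)
  · exact mul_pos hτ (Finset.prod_pos fun d _ => pow_pos (hx d) _)

theorem pairCoeff_nonneg {G : MultiGM.{u, v}} (hf : ∀ a s, 0 ≤ G.factor a s) (α : G.E)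
    {x : {e : G.E // e ≠ α} × Bool → ℝ} (hx : ∀ d, 0 < x d) (i j : Bool) :
    0 ≤ G.pairCoeff α x i j :=
  Finset.sum_nonneg fun _ _ =>
    mul_nonneg (weight_nonneg hf _) (Finset.prod_nonneg fun d _ => (pow_pos (hx d) _).le)

theorem pairCoeff_ofReal (x : {e : G.E // e ≠ α} × Bool → ℝ) (i j : Bool) :
    G.pairCoeff α (fun d => (x d : ℂ)) i j = (G.pairCoeff α x i j : ℝ) := by
  simp [pairCoeff]

theorem differentiable_pairCoeff (i j : Bool) :
    Differentiable ℂ (fun z : {e : G.E // e ≠ α} × Bool → ℂ => G.pairCoeff α z i j) := by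
  unfold pairCoeff
  fun_prop

theorem pairCoeff_mul_le {G : MultiGM.{u, v}} (hf : ∀ a s, 0 ≤ G.factor a s)
    (hG : BiStable G.poly) (α : G.E)
    {x : {e : G.E // e ≠ α} × Bool → ℝ} (hx : ∀ d, 0 < x d) :
    G.pairCoeff α x true false * G.pairCoeff α x false true ≤
      G.pairCoeff α x false false * G.pairCoeff α x true true := by
  by_contra! hlt
  have hA := pairCoeff_nonneg hf α hx false false
  have hB := pairCoeff_nonneg hf α hx true false
  have hC := pairCoeff_nonneg hf α hx false true
  have hD := pairCoeff_nonneg hf α hx true true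
  have hcont : ∀ i j, Continuous (fun ε => G.pairCoeff α (signedShift x ε) i j) := fun i j =>
    (G.differentiable_pairCoeff α i j).continuous.comp (continuous_signedShift x)
  have hzero : ∀ i j, G.pairCoeff α (signedShift x 0) i j = (G.pairCoeff α x i j : ℝ) :=
    fun i j => by rw [signedShift_zero, pairCoeff_ofReal]
  set c : Bool → Bool → ℝ := fun i j => G.pairCoeff α x i j
  change c true false * c false true > _ at hlt
  have hC' : 0 < c false true := by
    refine lt_of_le_of_ne hC fun h => ?_
    rw [← h, mul_zero] at hlt
    exact absurd hlt (not_lt.mpr (mul_nonneg hA hD))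
  have hden : G.pairCoeff α (signedShift x 0) false true +
      G.pairCoeff α (signedShift x 0) true true * Complex.I ≠ 0 := by
    rw [hzero, hzero]
    intro h
    have := congrArg Complex.re h
    simp at this
    exact hC'.ne' this
  have hdenc : ContinuousAt (fun ε => G.pairCoeff α (signedShift x ε) false true +
      G.pairCoeff α (signedShift x ε) true true * Complex.I) 0 :=
    ((hcont _ _).add ((hcont _ _).mul continuous_const)).continuousAt
  have hY : ContinuousAt (fun ε => ((G.pairCoeff α (signedShift x ε) false false +
      G.pairCoeff α (signedShift x ε) true false * Complex.I) /
      (G.pairCoeff α (signedShift x ε) false true +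
      G.pairCoeff α (signedShift x ε) true true * Complex.I)).im) 0 :=
    Complex.continuous_im.continuousAt.comp
      (((hcont _ _).add ((hcont _ _).mul continuous_const)).continuousAt.div hdenc hden)
  have hY0 : 0 < ((G.pairCoeff α (signedShift x 0) false false +
      G.pairCoeff α (signedShift x 0) true false * Complex.I) /
      (G.pairCoeff α (signedShift x 0) false true +
      G.pairCoeff α (signedShift x 0) true true * Complex.I)).im := by
    simp only [hzero]
    have hn : 0 < Complex.normSq (((c false true : ℝ) : ℂ) + ((c true true : ℝ) : ℂ) * Complex.I) := by
      rw [Complex.normSq_pos]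
      simpa only [hzero] using hden
    rw [Complex.div_im, ← sub_div]
    refine div_pos ?_ hn
    simp
    change _ < c true false * c false true
    linarith
  have hev := (hY.eventually (lt_mem_nhds hY0)).and (hdenc.eventually_ne hden)
  obtain ⟨ε, ⟨h1, h2⟩, hε⟩ := ((hev.filter_mono nhdsWithin_le_nhds).and
    (self_mem_nhdsWithin : Set.Ioi (0 : ℝ) ∈ nhdsWithin 0 (Set.Ioi 0))).exists
  have h3 := (biStable_iff _).mp hG _
    (extendPair_mem_signedHalfSpace (signedShift_mem x hε) (x := Complex.I) (by simp) h1)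
  rw [aeval_poly_extendPair] at h3
  refine h3 ?_
  have h4 := div_mul_cancel₀ (G.pairCoeff α (signedShift x ε) false false +
      G.pairCoeff α (signedShift x ε) true false * Complex.I) h2
  linear_combination -h4

theorem norm_aeval_poly_le {G : MultiGM.{u, v}} (hG : BiStable G.poly) (α : G.E)
    {z : {e : G.E // e ≠ α} × Bool → ℂ} (hz : z ∈ signedHalfSpace {e : G.E // e ≠ α}) :
    ‖aeval (extendPair α z (-Complex.I) Complex.I) G.poly‖ ≤
      ‖aeval (extendPair α z Complex.I (-Complex.I)) G.poly‖ := by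
  refine Complex.norm_le_norm_of_quadratic_ne_zero
    (b := 2 * (G.pairCoeff α z true true - G.pairCoeff α z false false)) fun t ht h0 => ?_
  have ht1 : 1 - t ≠ 0 := by
    intro h
    rw [← sub_eq_zero.mp h] at ht
    simp at ht
  have him : 0 < (Complex.I * ((1 + t) / (1 - t))).im := by
    rw [Complex.I_mul_im, Complex.div_re, ← add_div]
    refine div_pos ?_ (Complex.normSq_pos.mpr ht1)
    have h1 : Complex.normSq t < 1 := by
      rw [Complex.normSq_eq_norm_sq]
      nlinarith [norm_nonneg t]
    rw [Complex.normSq_apply] at h1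
    simp
    nlinarith
  have h3 := (biStable_iff _).mp hG _ (extendPair_mem_signedHalfSpace hz him him)
  refine h3 ?_
  rw [aeval_poly_extendPair] at h0 ⊢
  rw [aeval_poly_extendPair] at h0
  field_simp
  ring_nf at h0 ⊢
  simp only [Complex.I_sq] at h0 ⊢
  linear_combination h0

theorem biStable_contract {G : MultiGM.{u, v}} (hf : ∀ a s, 0 ≤ G.factor a s)
    (hZ : 0 < G.partitionFunction) (hG : BiStable G.poly) (α : G.E) (s : Bool) :
    BiStable (G.contract α s).poly := by
  rw [biStable_iff]
  intro z₀ hz₀ h0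
  have hG' := (biStable_iff _).mp hG
  set U := signedHalfSpace {e : G.E // e ≠ α}
  let p : ({e : G.E // e ≠ α} × Bool → ℂ) → ℂ := fun z =>
    aeval (extendPair α z Complex.I (-Complex.I)) G.poly
  let q : ({e : G.E // e ≠ α} × Bool → ℂ) → ℂ := fun z =>
    aeval (extendPair α z (-Complex.I) Complex.I) G.poly
  have hp : ∀ z ∈ U, p z ≠ 0 := fun z hz =>
    hG' _ (extendPair_mem_signedHalfSpace hz (by simp) (by simp))
  have hd : ∀ x y, Differentiable ℂ
      (fun z : {e : G.E // e ≠ α} × Bool → ℂ => aeval (extendPair α z x y) G.poly) := by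
    intro x y
    simp only [aeval_poly_extendPair]
    have := G.differentiable_pairCoeff α
    fun_prop
  have hsum : ∀ z : {e : G.E // e ≠ α} × Bool → ℂ,
      p z + q z = 2 * aeval z (G.contract α s).poly := by
    intro z
    simp only [p, q, aeval_contract_poly, aeval_poly_extendPair]
    linear_combination -2 * G.pairCoeff α z true true * Complex.I_mul_I
  have hq0 : q z₀ = -p z₀ := by
    have := hsum z₀
    have h1 : p z₀ + q z₀ = 2 * 0 := this.trans (congrArg (2 * ·) h0)
    linear_combination h1
  have heq : Set.EqOn (fun z => q z / p z) (Function.const _ (q z₀ / p z₀)) U := by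
    have hdiff : DifferentiableOn ℂ (fun z => q z / p z) U := by
      simp only [div_eq_mul_inv]
      exact (hd _ _).differentiableOn.mul ((hd _ _).differentiableOn.inv hp)
    refine Complex.eqOn_of_isPreconnected_of_isMaxOn_norm
      (convex_signedHalfSpace _).isPreconnected (isOpen_signedHalfSpace _)
      hdiff hz₀ fun z hz => ?_
    change ‖q z / p z‖ ≤ ‖q z₀ / p z₀‖
    rw [hq0, norm_div, norm_div, norm_neg, div_self (norm_ne_zero_iff.mpr (hp _ hz₀)), div_le_one (norm_pos_iff.mpr (hp z hz))]
    exact norm_aeval_poly_le hG α hz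
  have hU : ∀ z ∈ U, aeval z (G.contract α s).poly = 0 := by
    intro z hz
    have h1 : q z / p z = q z₀ / p z₀ := heq hz
    rw [hq0, neg_div, div_self (hp _ hz₀), div_eq_iff (hp z hz)] at h1
    have := hsum z
    rw [h1] at this
    simpa using this.symm
  have hpos := aeval_poly_pos (contract_factor_nonneg G α s hf)
    (by rwa [partitionFunction_contract]) (x := fun _ => 1) (fun _ => one_pos)
  have hc : Continuous (fun ε => G.pairCoeff α (signedShift (fun _ => 1) ε) false false +
      G.pairCoeff α (signedShift (fun _ => 1) ε) true true) :=
    (((G.differentiable_pairCoeff α _ _).continuous.comp (continuous_signedShift _)).add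
      ((G.differentiable_pairCoeff α _ _).continuous.comp (continuous_signedShift _)))
  have hlim := (hc.tendsto 0).mono_left (nhdsWithin_le_nhds (s := Set.Ioi 0))
  have hlim0 : Filter.Tendsto (fun ε => G.pairCoeff α (signedShift (fun _ => 1) ε) false false +
      G.pairCoeff α (signedShift (fun _ => 1) ε) true true) (nhdsWithin 0 (Set.Ioi 0))
      (nhds 0) := by
    refine tendsto_const_nhds.congr' ?_
    filter_upwards [self_mem_nhdsWithin] with ε hε
    rw [← aeval_contract_poly G α s]
    exact (hU _ (signedShift_mem _ hε)).symm
  have hval := tendsto_nhds_unique hlim hlim0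
  rw [signedShift_zero, pairCoeff_ofReal, pairCoeff_ofReal, ← Complex.ofReal_add,
    ← aeval_contract_poly G α s] at hval
  exact hpos.ne' (Complex.ofReal_eq_zero.mp hval)

end MultiGM

theorem exists_pos_mul_eq_and_le {A B C D t : ℝ} (hA : 0 ≤ A) (hB : 0 ≤ B) (hC : 0 ≤ C)
    (hD : 0 ≤ D) (hBC : B * C ≤ A * D) (hAD : 0 < A + D) (ht : 0 < t) :
    ∃ x > 0, ∃ y > 0, x * y = t ∧ B * x + C * y ≤ A * t + D := by
  have hpos : 0 < A * t + D := by
    rcases hA.eq_or_lt with rfl | hA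
    · linarith
    · positivity
  rcases hB.eq_or_lt with rfl | hB
  · refine ⟨(C + 1) * t / (A * t + D), by positivity, (A * t + D) / (C + 1), by positivity, ?_, ?_⟩
    · have := hpos.ne'
      have : C + 1 ≠ 0 := by positivity
      rw [div_mul_div_comm, div_eq_iff (by positivity)]
      ring
    · rw [zero_mul, zero_add, mul_div_assoc', div_le_iff₀ (by positivity)]
      nlinarith
  · rcases hD.eq_or_lt with rfl | hD
    · have hC0 : C = 0 := by
        rcases hC.eq_or_lt with h | h
        · exact h.symm
        · nlinarith [mul_pos hB h]
      subst hC0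
      refine ⟨A * t / B, ?_, B / A, ?_, ?_, ?_⟩
      · have : 0 < A := by linarith
        positivity
      · have : 0 < A := by linarith
        positivity
      · have : 0 < A := by linarith
        field_simp
      · have h1 : B * (A * t / B) = A * t := by field_simp
        linarith
    · refine ⟨D / B, by positivity, B * t / D, by positivity, by field_simp, ?_⟩
      have h1 : B * (D / B) = D := by field_simp
      have h2 : C * (B * t / D) ≤ A * t := by
        rw [mul_div_assoc', div_le_iff₀ hD]
        nlinarith
      linarith

theorem binaryEntropy_add_le_log_of_forall {A B C D β r : ℝ} (hA : 0 ≤ A) (hB : 0 ≤ B)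
    (hC : 0 ≤ C) (hD : 0 ≤ D) (hBC : B * C ≤ A * D) (hAD : 0 < A + D) (hβ0 : 0 ≤ β) (hβ1 : β ≤ 1)
    (h : ∀ x > 0, ∀ y > 0,
      β * (Real.log x + Real.log y) + r ≤ Real.log (A + B * x + C * y + D * x * y)) :
    β * Real.log β + (1 - β) * Real.log (1 - β) + r ≤ Real.log (A + D) := by
  have key : ∀ t > 0, β * Real.log t + r ≤ Real.log (A + D) + Real.log (1 + t) := by
    intro t ht
    obtain ⟨x, hx, y, hy, rfl, hle⟩ := exists_pos_mul_eq_and_le hA hB hC hD hBC hAD ht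
    rw [← Real.log_mul hAD.ne' (by positivity), Real.log_mul hx.ne' hy.ne']
    refine (h x hx y hy).trans (Real.log_le_log ?_ (by nlinarith))
    rcases hA.eq_or_lt with rfl | hA
    · have : 0 < D := by linarith
      positivity
    · positivity
  have hlog : ∀ s : ℝ, 0 < s → Real.log (1 + s) ≤ s := fun s hs => by
    have := Real.log_le_sub_one_of_pos (show 0 < 1 + s by linarith)
    linarith
  rcases hβ0.eq_or_lt with rfl | hβ0
  · refine le_of_forall_pos_le_add fun s hs => ?_
    have := key s hs
    have := hlog s hs
    simp
    linarith
  rcases hβ1.eq_or_lt with rfl | hβ1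
  · refine le_of_forall_pos_le_add fun s hs => ?_
    have h1 := key s⁻¹ (by positivity)
    have h2 := hlog s hs
    have h3 : 1 + s⁻¹ = (1 + s) * s⁻¹ := by field_simp; ring
    rw [h3, Real.log_mul (by positivity) (by positivity)] at h1
    simp
    linarith
  · have h1β : 0 < 1 - β := by linarith
    have h1 := key (β / (1 - β)) (by positivity)
    have h2 : 1 + β / (1 - β) = (1 - β)⁻¹ := by field_simp; ring
    rw [h2, Real.log_inv, Real.log_div hβ0.ne' h1β.ne'] at h1
    linarith

open scoped Pointwise in
/-- Lagrange duality for a convex function on a compact convex set under linear constraints. -/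
theorem exists_mem_eq_and_le_of_forall_lagrangian {F ι : Type*} [AddCommGroup F] [Module ℝ F]
    [TopologicalSpace F] [Fintype ι] {K : Set F} (hK : IsCompact K) {m : F →ₗ[ℝ] (ι → ℝ)}
    (hm : Continuous m) {Φ : F → ℝ} (hΦ : ConvexOn ℝ K Φ) (hΦc : Continuous Φ)
    {β : ι → ℝ} {r : ℝ} (h : ∀ c : ι → ℝ, ∃ b ∈ K, Φ b + ∑ d, c d * (m b d - β d) ≤ r) :
    ∃ b ∈ K, m b = β ∧ Φ b ≤ r := by
  classical
  set T : Set ((ι → ℝ) × ℝ) := {p | ∃ b ∈ K, m b = p.1 ∧ Φ b ≤ p.2} with hT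
  by_contra hcon
  have hmem : (β, r) ∉ T := hcon
  have hTc : IsClosed T := by
    have hT' : T = (fun b => (m b, Φ b)) '' K +
        (({0} : Set (ι → ℝ)) ×ˢ Set.Ici (0 : ℝ)) := by
      ext ⟨v, c⟩
      simp only [hT, Set.mem_ofPred_eq, Set.mem_add, Set.mem_image, Set.mem_prod,
        Set.mem_singleton_iff, Set.mem_Ici]
      constructor
      · rintro ⟨b, hb, h1, h2⟩
        exact ⟨_, ⟨b, hb, rfl⟩, (0, c - Φ b), ⟨rfl, by simpa using h2⟩, by simp [h1]⟩
      · rintro ⟨_, ⟨b, hb, rfl⟩, ⟨v', c'⟩, ⟨h1, h2⟩, h3⟩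
        simp only [Prod.mk_add_mk, Prod.mk.injEq] at h1 h2 h3
        refine ⟨b, hb, ?_, ?_⟩
        · rw [← h3.1, h1, add_zero]
        · linarith [h3.2]
    rw [hT']
    exact (isClosed_singleton.prod isClosed_Ici).add_left_of_isCompact
      (hK.image (hm.prodMk hΦc))
  have hTconv : Convex ℝ T := by
    rintro ⟨v, c⟩ ⟨b, hb, h1, h2⟩ ⟨v', c'⟩ ⟨b', hb', h1', h2'⟩ s t hs ht hst
    refine ⟨s • b + t • b', hΦ.1 hb hb' hs ht hst, ?_, ?_⟩
    · simp only at h1 h1'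
      simp [h1, h1']
    · refine (hΦ.2 hb hb' hs ht hst).trans ?_
      simp only [smul_eq_mul, Prod.snd_add, Prod.smul_snd] at *
      gcongr
  obtain ⟨f, u, hfu, hT1⟩ := geometric_hahn_banach_point_closed hTconv hTc hmem
  set μ : ℝ := f (0, 1) with hμ
  set c : ι → ℝ := fun d => f (Pi.single d 1, 0) with hc
  have hf : ∀ (v : ι → ℝ) (x : ℝ), f (v, x) = ∑ d, c d * v d + μ * x := by
    intro v x
    have h1 : (v, x) = ∑ d, v d • ((Pi.single d 1, 0) : (ι → ℝ) × ℝ) + x • (0, 1) := by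
      ext d
      · simp [Prod.fst_sum, Finset.sum_apply, Pi.single_apply]
      · simp [Prod.snd_sum]
    rw [h1, map_add, map_sum, map_smul]
    simp only [map_smul, smul_eq_mul, hc, hμ, mul_comm]
  obtain ⟨b₀, hb₀, -⟩ := h 0
  have hμ0 : 0 ≤ μ := by
    by_contra! hneg
    have h1 := hT1 (m b₀, Φ b₀ + |f (m b₀, Φ b₀) - u| / (-μ)) ⟨b₀, hb₀, rfl, by
      have : 0 ≤ |f (m b₀, Φ b₀) - u| / (-μ) := div_nonneg (abs_nonneg _) (by linarith)
      linarith⟩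
    rw [hf, mul_add] at h1
    have h2 : μ * (|f (m b₀, Φ b₀) - u| / (-μ)) = -|f (m b₀, Φ b₀) - u| := by
      have := hneg.ne
      field_simp
    rw [h2, hf] at h1
    linarith [le_abs_self (∑ d, c d * m b₀ d + μ * Φ b₀ - u)]
  obtain ⟨M, hM⟩ := hK.exists_bound_of_continuousOn (f := fun b => Φ b - r)
    (hΦc.sub continuous_const).continuousOn
  have hM0 : 0 ≤ M := (norm_nonneg _).trans (hM b₀ hb₀)
  set δ := (u - f (β, r)) / (M + 1) with hδ
  have hδ0 : 0 < δ := div_pos (by linarith) (by linarith)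
  have hδM : δ * (M + 1) = u - f (β, r) := by
    rw [hδ]
    field_simp
  obtain ⟨b, hb, hle⟩ := h (fun d => c d / (μ + δ))
  have h1 := hT1 (m b, Φ b) ⟨b, hb, rfl, le_rfl⟩
  have h2 := hM b hb
  rw [Real.norm_eq_abs, abs_le] at h2
  have h3 : ∑ d, c d / (μ + δ) * (m b d - β d) = (∑ d, c d * m b d - ∑ d, c d * β d) / (μ + δ) := by
    rw [← Finset.sum_sub_distrib, Finset.sum_div]
    refine Finset.sum_congr rfl fun d _ => ?_
    ring
  have h4 : (∑ d, c d * m b d - ∑ d, c d * β d) / (μ + δ) ≤ r - Φ b := by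
    rw [← h3]
    linarith
  rw [div_le_iff₀ (by linarith)] at h4
  rw [hf] at h1 hδM
  nlinarith

/-- Gibbs' inequality. -/
theorem neg_log_sum_le {S : Type*} [Fintype S] {b q : S → ℝ} (hb : ∀ s, 0 ≤ b s)
    (hb1 : ∑ s, b s = 1) (hq : ∀ s, 0 ≤ q s) (hbq : ∀ s, q s = 0 → b s = 0)
    (hpos : 0 < ∑ s, q s) :
    -Real.log (∑ s, q s) ≤ ∑ s, (b s * Real.log (b s) - b s * Real.log (q s)) := by
  set H := ∑ s, q s
  have h1 : ∀ s, b s - q s / H - b s * Real.log H ≤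
      b s * Real.log (b s) - b s * Real.log (q s) := by
    intro s
    rcases (hb s).eq_or_lt with h0 | h0
    · rw [← h0]
      have : 0 ≤ q s / H := div_nonneg (hq s) hpos.le
      simp
      linarith
    · have hqs : 0 < q s := lt_of_le_of_ne (hq s) fun h => h0.ne' (hbq s h.symm)
      have h2 := Real.log_le_sub_one_of_pos (show 0 < q s / H / b s by positivity)
      rw [Real.log_div (by positivity) h0.ne', Real.log_div hqs.ne' hpos.ne'] at h2
      have h3 := mul_le_mul_of_nonneg_left h2 h0.le
      have h4 : b s * (q s / H / b s - 1) = q s / H - b s := by field_simp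
      rw [h4] at h3
      linarith
  have h2 := Finset.sum_le_sum fun s (_ : s ∈ Finset.univ) => h1 s
  rw [Finset.sum_sub_distrib, Finset.sum_sub_distrib, ← Finset.sum_div, ← Finset.sum_mul, hb1,
    div_self hpos.ne'] at h2
  linarith

theorem sum_gibbs {S : Type*} [Fintype S] {q : S → ℝ} (hpos : 0 < ∑ s, q s) :
    ∑ s, (q s / (∑ s, q s) * Real.log (q s / ∑ s, q s) - q s / (∑ s, q s) * Real.log (q s)) =
      -Real.log (∑ s, q s) := by
  set H := ∑ s, q s
  have h1 : ∀ s, q s / H * Real.log (q s / H) - q s / H * Real.log (q s) =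
      q s / H * -Real.log H := by
    intro s
    by_cases h : q s = 0
    · simp [h]
    · rw [Real.log_div h hpos.ne']
      ring
  rw [Finset.sum_congr rfl fun s _ => h1 s, ← Finset.sum_mul, ← Finset.sum_div,
    div_self hpos.ne', one_mul]

namespace MultiGM

variable (G : MultiGM.{u, v})

/-- The families of probability distributions that vanish where the factors vanish. -/
def supportedBeliefs : Set ((a : G.V) → G.LocalConfig a → ℝ) :=
  {b | ∀ a, (∀ s, 0 ≤ b a s) ∧ ∑ s, b a s = 1 ∧ ∀ s, G.factor a s = 0 → b a s = 0}

/-- The sum over the nodes of the divergences of the beliefs from the factors. -/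
noncomputable def divergence (b : (a : G.V) → G.LocalConfig a → ℝ) : ℝ :=
  ∑ a, ∑ s, (b a s * Real.log (b a s) - b a s * Real.log (G.factor a s))

/-- The probability that a directed edge has bit `1`. -/
def marginal : ((a : G.V) → G.LocalConfig a → ℝ) →ₗ[ℝ] (G.E × Bool → ℝ) where
  toFun b d := ∑ s : G.LocalConfig (G.node d) with s ⟨d, rfl⟩ = true, b (G.node d) s
  map_add' b b' := by
    funext d
    simp [Finset.sum_add_distrib]
  map_smul' c b := by
    funext d
    simp [Finset.mul_sum]

theorem marginal_dirEdge (b : (a : G.V) → G.LocalConfig a → ℝ) (a : G.V) (d : G.DirEdges a) :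
    ∑ s : G.LocalConfig a with s d = true, b a s = G.marginal b d.1 := by
  obtain ⟨d, rfl⟩ := d
  rfl

theorem continuous_marginal : Continuous G.marginal := by
  change Continuous (fun (b : (a : G.V) → G.LocalConfig a → ℝ) (d : G.E × Bool) =>
    ∑ s : G.LocalConfig (G.node d) with s ⟨d, rfl⟩ = true, b (G.node d) s)
  fun_prop

theorem continuous_divergence : Continuous G.divergence := by
  unfold divergence
  refine continuous_finsetSum _ fun a _ => continuous_finsetSum _ fun s _ => ?_
  have : Continuous (fun b : (a : G.V) → G.LocalConfig a → ℝ => b a s) := by fun_prop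
  exact (Real.continuous_mul_log.comp this).sub (this.mul continuous_const)

theorem le_one_of_mem_supportedBeliefs {b : (a : G.V) → G.LocalConfig a → ℝ}
    (hb : b ∈ G.supportedBeliefs) (a : G.V) (s : G.LocalConfig a) : b a s ≤ 1 := by
  rw [← (hb a).2.1]
  exact Finset.single_le_sum (fun s _ => (hb a).1 s) (Finset.mem_univ s)

theorem isCompact_supportedBeliefs : IsCompact G.supportedBeliefs := by
  refine IsCompact.of_isClosed_subset
    (isCompact_Icc (a := (0 : (a : G.V) → G.LocalConfig a → ℝ)) (b := 1)) ?_ fun b hb =>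
      ⟨fun a s => (hb a).1 s, fun a s => G.le_one_of_mem_supportedBeliefs hb a s⟩
  have h : G.supportedBeliefs = ⋂ a, ({b | ∀ s, 0 ≤ b a s} ∩ ({b | ∑ s, b a s = 1} ∩
      {b | ∀ s, G.factor a s = 0 → b a s = 0})) := by
    ext b
    simp [supportedBeliefs]
  rw [h]
  refine isClosed_iInter fun a => IsClosed.inter ?_ (IsClosed.inter ?_ ?_)
  · rw [Set.ofPred_forall]
    exact isClosed_iInter fun s => isClosed_le continuous_const (by fun_prop)
  · exact isClosed_eq (by fun_prop) continuous_const
  · simp only [Set.ofPred_forall]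
    exact isClosed_iInter fun s => isClosed_iInter fun _ =>
      isClosed_eq (by fun_prop) continuous_const

theorem convex_supportedBeliefs : Convex ℝ G.supportedBeliefs := by
  intro b hb b' hb' s t hs ht hst a
  refine ⟨fun x => ?_, ?_, fun x hx => ?_⟩
  · exact add_nonneg (mul_nonneg hs ((hb a).1 x)) (mul_nonneg ht ((hb' a).1 x))
  · simp [Finset.sum_add_distrib, ← Finset.mul_sum, (hb a).2.1, (hb' a).2.1, hst]
  · simp [(hb a).2.2 x hx, (hb' a).2.2 x hx]

theorem convexOn_divergence : ConvexOn ℝ G.supportedBeliefs G.divergence := by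
  refine ⟨G.convex_supportedBeliefs, fun b hb b' hb' s t hs ht hst => ?_⟩
  simp only [divergence, smul_eq_mul, Finset.mul_sum, ← Finset.sum_add_distrib]
  refine Finset.sum_le_sum fun a _ => Finset.sum_le_sum fun x _ => ?_
  have h := Real.convexOn_mul_log.2 (Set.mem_Ici.mpr ((hb a).1 x))
    (Set.mem_Ici.mpr ((hb' a).1 x)) hs ht hst
  simp only [smul_eq_mul, Pi.add_apply, Pi.smul_apply] at h ⊢
  linarith

/-- The factor of a node, tilted by exponential weights of its directed edges. -/
noncomputable def tiltedFactor (c : G.E × Bool → ℝ) (a : G.V) (s : G.LocalConfig a) : ℝ :=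
  G.factor a s * ∏ d : G.DirEdges a, Real.exp (-c d.1) ^ (s d).toNat

theorem tiltedFactor_eq_zero_iff (c : G.E × Bool → ℝ) (a : G.V) (s : G.LocalConfig a) :
    G.tiltedFactor c a s = 0 ↔ G.factor a s = 0 := by
  have : ∏ d : G.DirEdges a, Real.exp (-c d.1) ^ (s d).toNat ≠ 0 :=
    (Finset.prod_pos fun d _ => pow_pos (Real.exp_pos _) _).ne'
  simp [tiltedFactor, this]

theorem prod_sum_tiltedFactor (c : G.E × Bool → ℝ) :
    ∏ a, ∑ s, G.tiltedFactor c a s = aeval (fun d => Real.exp (-c d)) G.poly := by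
  simp only [poly, map_prod, aeval_nodePoly]
  rfl

theorem divergence_add_marginal {b : (a : G.V) → G.LocalConfig a → ℝ}
    (hb : b ∈ G.supportedBeliefs) (c : G.E × Bool → ℝ) :
    G.divergence b + ∑ d, c d * G.marginal b d =
      ∑ a, ∑ s, (b a s * Real.log (b a s) - b a s * Real.log (G.tiltedFactor c a s)) := by
  rw [divergence, ← Fintype.sum_fiberwise G.node (fun d => c d * G.marginal b d),
    ← Finset.sum_add_distrib]
  refine Finset.sum_congr rfl fun a _ => ?_
  have h1 : ∀ d : G.DirEdges a, c d.1 * G.marginal b d.1 =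
      ∑ s, b a s * (c d.1 * (s d).toNat) := by
    intro d
    rw [← marginal_dirEdge, Finset.sum_filter, Finset.mul_sum]
    refine Finset.sum_congr rfl fun s _ => ?_
    cases s d <;> simp [mul_comm]
  rw [Finset.sum_congr rfl fun d _ => h1 d, Finset.sum_comm, ← Finset.sum_add_distrib]
  refine Finset.sum_congr rfl fun s _ => ?_
  by_cases h : G.factor a s = 0
  · simp [(hb a).2.2 s h]
  · have h2 : ∏ d : G.DirEdges a, Real.exp (-c d.1) ^ (s d).toNat ≠ 0 :=
      (Finset.prod_pos fun d _ => pow_pos (Real.exp_pos _) _).ne'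
    rw [tiltedFactor, Real.log_mul h h2, Real.log_prod fun _ _ => (pow_pos (Real.exp_pos _) _).ne',
      ← Finset.mul_sum]
    simp only [Real.log_pow, Real.log_exp, mul_neg, Finset.sum_neg_distrib, mul_comm (c _)]
    ring

variable {G}

theorem tiltedFactor_nonneg (hf : ∀ a s, 0 ≤ G.factor a s) (c : G.E × Bool → ℝ) (a : G.V)
    (s : G.LocalConfig a) : 0 ≤ G.tiltedFactor c a s :=
  mul_nonneg (hf a s) (Finset.prod_pos fun _ _ => pow_pos (Real.exp_pos _) _).le

theorem sum_tiltedFactor_pos (hf : ∀ a s, 0 ≤ G.factor a s) (hZ : 0 < G.partitionFunction)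
    (c : G.E × Bool → ℝ) (a : G.V) : 0 < ∑ s, G.tiltedFactor c a s := by
  refine lt_of_le_of_ne (Finset.sum_nonneg fun s _ => tiltedFactor_nonneg hf c a s) fun h => ?_
  have h1 := aeval_poly_pos hf hZ (x := fun d => Real.exp (-c d)) fun d => Real.exp_pos _
  rw [← prod_sum_tiltedFactor, Finset.prod_eq_zero (Finset.mem_univ a) h.symm] at h1
  exact lt_irrefl _ h1

theorem neg_log_aeval_poly_le (hf : ∀ a s, 0 ≤ G.factor a s) (hZ : 0 < G.partitionFunction)
    {b : (a : G.V) → G.LocalConfig a → ℝ} (hb : b ∈ G.supportedBeliefs) (c : G.E × Bool → ℝ) :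
    -Real.log (aeval (fun d => Real.exp (-c d)) G.poly) ≤
      G.divergence b + ∑ d, c d * G.marginal b d := by
  rw [divergence_add_marginal G hb, ← prod_sum_tiltedFactor,
    Real.log_prod fun a _ => (sum_tiltedFactor_pos hf hZ c a).ne', ← Finset.sum_neg_distrib]
  exact Finset.sum_le_sum fun a _ => neg_log_sum_le (hb a).1 (hb a).2.1
    (tiltedFactor_nonneg hf c a)
    (fun s hs => (hb a).2.2 s ((G.tiltedFactor_eq_zero_iff c a s).mp hs))
    (sum_tiltedFactor_pos hf hZ c a)

theorem exists_divergence_add_marginal_eq (hf : ∀ a s, 0 ≤ G.factor a s)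
    (hZ : 0 < G.partitionFunction) (c : G.E × Bool → ℝ) :
    ∃ b ∈ G.supportedBeliefs, G.divergence b + ∑ d, c d * G.marginal b d =
      -Real.log (aeval (fun d => Real.exp (-c d)) G.poly) := by
  have hpos := sum_tiltedFactor_pos hf hZ c
  have hb : (fun a s => G.tiltedFactor c a s / ∑ s, G.tiltedFactor c a s) ∈
      G.supportedBeliefs := fun a =>
    ⟨fun s => div_nonneg (tiltedFactor_nonneg hf c a s) (hpos a).le,
      by rw [← Finset.sum_div, div_self (hpos a).ne'],
      fun s hs => by
        change _ / _ = _
        rw [(G.tiltedFactor_eq_zero_iff c a s).mpr hs, zero_div]⟩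
  refine ⟨_, hb, ?_⟩
  rw [divergence_add_marginal G hb, ← prod_sum_tiltedFactor,
    Real.log_prod fun a _ => (hpos a).ne', ← Finset.sum_neg_distrib]
  exact Finset.sum_congr rfl fun a _ => sum_gibbs (hpos a)

/-- Strong duality between beliefs with given marginals and the polynomial of the model. -/
theorem exists_marginal_eq_and_divergence_le (hf : ∀ a s, 0 ≤ G.factor a s)
    (hZ : 0 < G.partitionFunction) {β : G.E × Bool → ℝ} {r : ℝ}
    (h : ∀ c : G.E × Bool → ℝ,
      -Real.log (aeval (fun d => Real.exp (-c d)) G.poly) - ∑ d, c d * β d ≤ r) :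
    ∃ b ∈ G.supportedBeliefs, G.marginal b = β ∧ G.divergence b ≤ r := by
  refine exists_mem_eq_and_le_of_forall_lagrangian G.isCompact_supportedBeliefs
    G.continuous_marginal G.convexOn_divergence G.continuous_divergence fun c => ?_
  obtain ⟨b, hb, heq⟩ := exists_divergence_add_marginal_eq hf hZ c
  refine ⟨b, hb, ?_⟩
  have := h c
  simp only [mul_sub, Finset.sum_sub_distrib]
  linarith

end MultiGM

namespace MultiGM

variable {G : MultiGM.{u, v}}

theorem mem_supportedBeliefs {p : G.Beliefs} (hp : p ∈ G.beliefPolytope)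
    (hs : ∀ a s, G.factor a s = 0 → p.1 a s = 0) : p.1 ∈ G.supportedBeliefs :=
  fun a => ⟨fun s => (hp.1 a s).1, hp.2.2.1 a, hs a⟩

theorem marginal_eq {p : G.Beliefs} (hp : p ∈ G.beliefPolytope) :
    G.marginal p.1 = fun d => p.2 d.1 := by
  funext d
  exact hp.2.2.2 (G.node d) ⟨d, rfl⟩

theorem mem_beliefPolytope {b : (a : G.V) → G.LocalConfig a → ℝ} (hb : b ∈ G.supportedBeliefs)
    {β : G.E → ℝ} (hβ : ∀ α, β α ∈ Set.Icc (0 : ℝ) 1) (hm : G.marginal b = fun d => β d.1) :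
    (b, β) ∈ G.beliefPolytope :=
  ⟨fun a s => ⟨(hb a).1 s, G.le_one_of_mem_supportedBeliefs hb a s⟩, hβ, fun a => (hb a).2.1,
    fun a d => by rw [marginal_dirEdge, hm]⟩

theorem betheFreeEnergy_eq {p : G.Beliefs} (hs : ∀ a s, G.factor a s = 0 → p.1 a s = 0) :
    G.betheFreeEnergy p = ((G.divergence p.1 -
      ∑ α, (p.2 α * Real.log (p.2 α) + (1 - p.2 α) * Real.log (1 - p.2 α)) : ℝ) : EReal) := by
  rw [betheFreeEnergy, betheEnergy, if_pos hs, ← EReal.coe_sub]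
  congr 1
  simp only [betheEntropy, divergence, Finset.sum_sub_distrib]
  ring

theorem betheFreeEnergy_eq_top {p : G.Beliefs} (hs : ¬∀ a s, G.factor a s = 0 → p.1 a s = 0) :
    G.betheFreeEnergy p = ⊤ := by
  rw [betheFreeEnergy, betheEnergy, if_neg hs, EReal.top_sub_coe]

theorem binaryEntropy_le_log_aeval_contract_poly (hf : ∀ a s, 0 ≤ G.factor a s)
    (hZ : 0 < G.partitionFunction) (hG : BiStable G.poly) (α : G.E) (s : Bool)
    {p : G.Beliefs} (hp : p ∈ G.beliefPolytope) (hs : ∀ a s, G.factor a s = 0 → p.1 a s = 0)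
    (c : {e : G.E // e ≠ α} × Bool → ℝ) :
    p.2 α * Real.log (p.2 α) + (1 - p.2 α) * Real.log (1 - p.2 α) +
      (-G.divergence p.1 - ∑ d, c d * p.2 d.1) ≤
      Real.log (aeval (fun d => Real.exp (-c d)) (G.contract α s).poly) := by
  set x : {e : G.E // e ≠ α} × Bool → ℝ := fun d => Real.exp (-c d) with hx
  have hx0 : ∀ d, 0 < x d := fun d => Real.exp_pos _
  have hpos : 0 < aeval x (G.contract α s).poly :=
    aeval_poly_pos (contract_factor_nonneg G α s hf)
      (by rwa [partitionFunction_contract]) hx0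
  rw [aeval_contract_poly] at hpos ⊢
  refine binaryEntropy_add_le_log_of_forall (pairCoeff_nonneg hf α hx0 _ _)
    (pairCoeff_nonneg hf α hx0 true false) (pairCoeff_nonneg hf α hx0 false true)
    (pairCoeff_nonneg hf α hx0 _ _) (pairCoeff_mul_le hf hG α hx0) hpos (hp.2.1 α).1 (hp.2.1 α).2
    fun y hy z hz => ?_
  have h := neg_log_aeval_poly_le hf hZ (mem_supportedBeliefs hp hs)
    (extendPair α c (-Real.log y) (-Real.log z))
  have hexp : (fun d => Real.exp (-extendPair α c (-Real.log y) (-Real.log z) d)) =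
      extendPair α x y z := by
    funext d
    unfold extendPair
    split_ifs <;> simp [Real.exp_log, hy, hz, hx]
  rw [hexp, aeval_poly_extendPair, marginal_eq hp, sum_extendPair α] at h
  simp only [extendPair_false, extendPair_true, extendPair_of_ne] at h
  linarith

theorem Zvbp_le_Zvbp_contract (hf : ∀ a s, 0 ≤ G.factor a s)
    (hZ : 0 < G.partitionFunction) (hG : BiStable G.poly) (α : G.E) (s : Bool) :
    G.Zvbp ≤ (G.contract α s).Zvbp := by
  refine EReal.exp_monotone (EReal.neg_le_neg_iff.mpr (le_iInf₂ fun p hp => ?_))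
  by_cases hs : ∀ a s, G.factor a s = 0 → p.1 a s = 0
  swap
  · rw [betheFreeEnergy_eq_top hs]
    exact le_top
  have hle : ∀ c : {e : G.E // e ≠ α} × Bool → ℝ,
      -Real.log (aeval (fun d => Real.exp (-c d)) (G.contract α s).poly) - ∑ d, c d * p.2 d.1 ≤
        G.divergence p.1 - (p.2 α * Real.log (p.2 α) + (1 - p.2 α) * Real.log (1 - p.2 α)) := by
    intro c
    linarith [binaryEntropy_le_log_aeval_contract_poly hf hZ hG α s hp hs c]
  obtain ⟨b, hb, hm, hr⟩ := exists_marginal_eq_and_divergence_le (G := G.contract α s)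
    (contract_factor_nonneg G α s hf) (by rwa [partitionFunction_contract])
    (β := fun d : {e : G.E // e ≠ α} × Bool => p.2 d.1)
    hle
  refine iInf₂_le_of_le (b, fun e : {e : G.E // e ≠ α} => p.2 e.1)
    (mem_beliefPolytope hb (fun e => hp.2.1 e.1) hm) ?_
  rw [betheFreeEnergy_eq hs, betheFreeEnergy_eq fun a => (hb a).2.2, EReal.coe_le_coe_iff,
    ← Fintype.sum_subtype_add_sum_subtype (fun e => e ≠ α)
      (fun e => p.2 e * Real.log (p.2 e) + (1 - p.2 e) * Real.log (1 - p.2 e))]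
  have h1 : ∑ e : {e : G.E // ¬e ≠ α},
      (p.2 e * Real.log (p.2 e) + (1 - p.2 e) * Real.log (1 - p.2 e)) =
      p.2 α * Real.log (p.2 α) + (1 - p.2 α) * Real.log (1 - p.2 α) := by
    rw [Fintype.sum_eq_single ⟨α, not_not.mpr rfl⟩]
    exact fun e he => absurd (Subtype.ext (not_not.mp e.2)) he
  have h2 : ∀ t : ℝ, (G.contract α s).divergence b ≤ G.divergence p.1 - t →
      (G.contract α s).divergence b - ∑ e : {e : G.E // e ≠ α},
        (p.2 e * Real.log (p.2 e) + (1 - p.2 e) * Real.log (1 - p.2 e)) ≤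
      G.divergence p.1 - (∑ e : {e : G.E // e ≠ α},
        (p.2 e * Real.log (p.2 e) + (1 - p.2 e) * Real.log (1 - p.2 e)) + t) :=
    fun t ht => by linarith
  rw [h1]
  exact h2 _ hr

theorem aeval_poly_of_isEmpty [IsEmpty G.E] (x : G.E × Bool → ℝ) :
    aeval x G.poly = G.partitionFunction := by
  rw [aeval_poly, partitionFunction_eq_sum_weight, Fintype.sum_unique, Fintype.sum_unique,
    Finset.univ_eq_empty, Finset.prod_empty, mul_one]
  exact congrArg G.weight (Subsingleton.elim _ _)

theorem Zvbp_of_isEmpty [IsEmpty G.E] (hf : ∀ a s, 0 ≤ G.factor a s)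
    (hZ : 0 < G.partitionFunction) : G.Zvbp = ENNReal.ofReal G.partitionFunction := by
  have hF : G.variationalFreeEnergy = ((-Real.log G.partitionFunction : ℝ) : EReal) := by
    refine le_antisymm ?_ (le_iInf₂ fun p hp => ?_)
    · obtain ⟨b, hb, heq⟩ := exists_divergence_add_marginal_eq hf hZ 0
      refine iInf₂_le_of_le (b, isEmptyElim)
        (mem_beliefPolytope hb (fun e => isEmptyElim e) (funext fun d => isEmptyElim d.1)) ?_
      rw [betheFreeEnergy_eq fun a => (hb a).2.2, EReal.coe_le_coe_iff]
      rw [aeval_poly_of_isEmpty] at heq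
      simp at heq ⊢
      exact heq.le
    · by_cases hs : ∀ a s, G.factor a s = 0 → p.1 a s = 0
      · have h := neg_log_aeval_poly_le hf hZ (mem_supportedBeliefs hp hs) 0
        rw [aeval_poly_of_isEmpty] at h
        rw [betheFreeEnergy_eq hs, EReal.coe_le_coe_iff]
        simpa using h
      · rw [betheFreeEnergy_eq_top hs]
        exact le_top
  rw [Zvbp, hF, ← EReal.coe_neg, neg_neg, EReal.exp_coe, Real.exp_log hZ]

end MultiGM

theorem mainTheorem1 (G : MultiGM.{u, v})
    (hf : ∀ (a : G.V) (s : G.LocalConfig a), 0 ≤ G.factor a s)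
    (hZ : 0 < G.partitionFunction)
    (hG : BiStable G.poly)
    (S : ℕ → MultiGM.{u, v}) (hS : G.IsContractionSequence S) :
    (∀ m ≤ Fintype.card G.E, BiStable (S m).poly) ∧
      (S 0).Zvbp = G.Zvbp ∧
      (∀ m < Fintype.card G.E, (S m).Zvbp ≤ (S (m + 1)).Zvbp) ∧
      (S (Fintype.card G.E)).Zvbp = ENNReal.ofReal G.partitionFunction := by
  have key : ∀ m ≤ Fintype.card G.E, (∀ a s, 0 ≤ (S m).factor a s) ∧
      (S m).partitionFunction = G.partitionFunction ∧ BiStable (S m).poly ∧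
      Fintype.card (S m).E + m = Fintype.card G.E := by
    intro m
    induction m with
    | zero => exact fun _ => by rw [hS.zero]; exact ⟨hf, rfl, hG, rfl⟩
    | succ m ih =>
      intro hm
      obtain ⟨h1, h2, h3, h4⟩ := ih (by omega)
      obtain ⟨α, s, h⟩ := hS.succ m hm
      rw [h]
      refine ⟨(S m).contract_factor_nonneg α s h1, ((S m).partitionFunction_contract α s).trans h2,
        MultiGM.biStable_contract h1 (h2 ▸ hZ) h3 α s, ?_⟩
      have := (S m).card_contract α s
      omega
  refine ⟨fun m hm => (key m hm).2.2.1, by rw [hS.zero], fun m hm => ?_, ?_⟩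
  · obtain ⟨h1, h2, h3, -⟩ := key m hm.le
    obtain ⟨α, s, h⟩ := hS.succ m hm
    rw [h]
    exact MultiGM.Zvbp_le_Zvbp_contract h1 (h2 ▸ hZ) h3 α s
  · obtain ⟨h1, h2, -, h4⟩ := key _ le_rfl
    have : IsEmpty (S (Fintype.card G.E)).E := Fintype.card_eq_zero_iff.mp (by omega)
    rw [MultiGM.Zvbp_of_isEmpty h1 (h2 ▸ hZ), h2]
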